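/- Let $0<q<1$ and let $X_0, X_1, X_2, \ldots$ be independent, identically distributed, almost surely non-negative real random variables with $\mathbb{E}\log\max(X_0,1)<\infty$. Suppose that for some $\gamma>0$ and $K>0$ $$-\log \mathbb{P}(X_0\leq \varepsilon)\sim K\varepsilon^{-\gamma}\qquad\text{as }\varepsilon\downarrow 0.$$ Then the series $S=\sum_{n=0}^\infty q^n X_n$ converges almost surely, and $$-\log \mathbb{P}(S\leq\varepsilon)\sim \frac{K}{\bigl(1-q^{\gamma/(1+\gamma)}\bigr)^{1+\gamma}}\,\varepsilon^{-\gamma}\qquad\text{as }\varepsilon\downarrow 0.$$ Here $f\sim g$ means $\lim f/g=1$. -/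

import Mathlib

open MeasureTheory ProbabilityTheory Filter Topology Asymptotics

/-! Splitting off the first term gives `S = X₀ + q S'` with `S'` an independent copy of `S`. Write
small-ball constants as `a ^ (1 + γ)`. Under independent sums the roots `a` add (Radon's
inequality), and multiplying the variable by `q` multiplies the root by `r = q ^ (γ / (1 + γ))`. So
the root for `S` should solve `A = k + r A` with `k ^ (1 + γ) = K`, that is `A = k / (1 - r)`. The
bound `G ≤ exp` (`eventually_le_exp_of_perpetuity`) iterates `B ↦ k + r B` from the trivial `B = 0`.
The reverse bound (`eventually_neg_log_perpetuity_lt`) iterates `F s * G t ≤ G (s + q t)` at the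
optimal split `s = (1 - r) x`, `q t = r x`. -/

theorem isEquivalent_mul_rpow_neg_iff {f : ℝ → ℝ} {c γ : ℝ} (hc : c ≠ 0) :
    f ~[𝓝[>] (0 : ℝ)] (fun ε : ℝ => c * ε ^ (-γ)) ↔
      Tendsto (fun ε : ℝ => f ε * ε ^ γ) (𝓝[>] 0) (𝓝 c) := by
  have hne : ∀ᶠ ε : ℝ in 𝓝[>] 0, c * ε ^ (-γ) ≠ 0 := by
    filter_upwards [self_mem_nhdsWithin] with ε hε
    exact mul_ne_zero hc (Real.rpow_pos_of_pos hε _).ne'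
  have key : (fun ε : ℝ => f ε * ε ^ γ) =ᶠ[𝓝[>] 0]
      fun ε => c * (f / fun ε : ℝ => c * ε ^ (-γ)) ε := by
    filter_upwards [self_mem_nhdsWithin] with ε hε
    have : ε ^ γ ≠ 0 := (Real.rpow_pos_of_pos hε _).ne'
    simp only [Pi.div_apply, Real.rpow_neg (le_of_lt hε)]
    field_simp
  rw [isEquivalent_iff_tendsto_one hne, tendsto_congr' key]
  constructor
  · intro h
    simpa using h.const_mul c
  · intro h
    refine (h.const_mul c⁻¹).congr' ?_ |>.trans_eq ?_
    · exact Eventually.of_forall fun ε => by field_simp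
    · rw [inv_mul_cancel₀ hc]

/-- The two-term case of Radon's inequality. -/
theorem add_rpow_mul_rpow_neg_le {γ a b u v : ℝ} (hγ : 0 ≤ γ) (ha : 0 ≤ a) (hb : 0 ≤ b)
    (hu : 0 < u) (hv : 0 < v) :
    (a + b) ^ (1 + γ) * (u + v) ^ (-γ) ≤ a ^ (1 + γ) * u ^ (-γ) + b ^ (1 + γ) * v ^ (-γ) := by
  have aux : ∀ {x w : ℝ}, 0 ≤ x → 0 < w → w * (x / w) ^ (1 + γ) = x ^ (1 + γ) * w ^ (-γ) := by
    intro x w hx hw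
    rw [Real.div_rpow hx hw.le, Real.rpow_add hw, Real.rpow_one, Real.rpow_neg hw.le]
    have := (Real.rpow_pos_of_pos hw γ).ne'
    field_simp
  have huv : 0 < u + v := by positivity
  have h := (convexOn_rpow (p := 1 + γ) (by linarith)).2
    (show a / u ∈ Set.Ici (0 : ℝ) from div_nonneg ha hu.le)
    (show b / v ∈ Set.Ici (0 : ℝ) from div_nonneg hb hv.le)
    (show 0 ≤ u / (u + v) by positivity) (show 0 ≤ v / (u + v) by positivity)
    (by field_simp)
  simp only [smul_eq_mul] at h
  have e : u / (u + v) * (a / u) + v / (u + v) * (b / v) = (a + b) / (u + v) := by field_simp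
  rw [e] at h
  rw [← aux (add_nonneg ha hb) huv, ← aux ha hu, ← aux hb hv]
  calc (u + v) * ((a + b) / (u + v)) ^ (1 + γ)
      ≤ (u + v) * (u / (u + v) * (a / u) ^ (1 + γ) + v / (u + v) * (b / v) ^ (1 + γ)) := by
        gcongr
    _ = _ := by field_simp

theorem eventually_mul_exp_rpow_neg_le {γ c d e : ℝ} (hγ : 0 < γ) (hde : d < e) :
    ∀ᶠ ε : ℝ in 𝓝[>] 0, c * Real.exp (-(e * ε ^ (-γ))) ≤ Real.exp (-(d * ε ^ (-γ))) := by
  have h1 : Tendsto (fun ε : ℝ => Real.exp ((e - d) * ε ^ (-γ))) (𝓝[>] 0) atTop :=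
    Real.tendsto_exp_atTop.comp
      ((tendsto_rpow_neg_nhdsGT_zero (neg_lt_zero.2 hγ)).const_mul_atTop (sub_pos.2 hde))
  filter_upwards [h1.eventually_ge_atTop c] with ε hε
  calc c * Real.exp (-(e * ε ^ (-γ)))
      ≤ Real.exp ((e - d) * ε ^ (-γ)) * Real.exp (-(e * ε ^ (-γ))) := by gcongr
    _ = _ := by rw [← Real.exp_add]; ring_nf

/-- If `H` is the distribution function of a sum of independent non-negative random variables with
distribution functions `F` and `G`, then the `(1 + γ)`-th roots of the constants in exponential
small-ball bounds for `F` and `G` add up to a constant for `H`. -/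
theorem eventually_le_exp_of_le_sum {γ a b d : ℝ} {F G H : ℝ → ℝ} (hγ : 0 < γ)
    (ha : 0 ≤ a) (hb : 0 ≤ b) (hd : 0 ≤ d) (hdab : d < a + b)
    (hG0 : ∀ x, 0 ≤ G x)
    (hF : ∀ᶠ x : ℝ in 𝓝[>] 0, F x ≤ Real.exp (-(a ^ (1 + γ) * x ^ (-γ))))
    (hG : ∀ᶠ x : ℝ in 𝓝[>] 0, G x ≤ Real.exp (-(b ^ (1 + γ) * x ^ (-γ))))
    (hH : ∀ (m : ℕ) (x : ℝ), 0 < m → 0 < x →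
      H x ≤ ∑ j ∈ Finset.range (m + 1), F (((j : ℝ) + 1) / m * x) * G ((m - j + 1) / m * x)) :
    ∀ᶠ x : ℝ in 𝓝[>] 0, H x ≤ Real.exp (-(d ^ (1 + γ) * x ^ (-γ))) := by
  -- Rounding to a grid of mesh `x / m` inflates the total from `x` to `(1 + 2 / m) x`; the slack `d
  -- < a + b` pays for it.
  obtain ⟨m, hm0, hm⟩ : ∃ m : ℕ, 0 < m ∧
      d ^ (1 + γ) < (a + b) ^ (1 + γ) * (1 + 2 / (m : ℝ)) ^ (-γ) := by
    have h1 : Tendsto (fun m : ℕ => (a + b) ^ (1 + γ) * (1 + 2 / (m : ℝ)) ^ (-γ)) atTop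
        (𝓝 ((a + b) ^ (1 + γ))) := by
      have h2 : Tendsto (fun m : ℕ => 1 + 2 / (m : ℝ)) atTop (𝓝 1) := by
        simpa using (tendsto_const_div_atTop_nhds_zero_nat (2 : ℝ)).const_add 1
      simpa using (h2.rpow_const (p := -γ) (Or.inl one_ne_zero)).const_mul ((a + b) ^ (1 + γ))
    have h3 := h1.eventually_const_lt (Real.rpow_lt_rpow hd hdab (by linarith : 0 < 1 + γ))
    exact ((eventually_gt_atTop 0).and h3).exists
  have hmR : (0 : ℝ) < m := by exact_mod_cast hm0
  have h4 : ∀ᶠ x : ℝ in 𝓝[>] 0, ∀ j ∈ Finset.range (m + 1),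
      F (((j : ℝ) + 1) / m * x) * G ((m - j + 1) / m * x) ≤
        Real.exp (-((a + b) ^ (1 + γ) * (1 + 2 / (m : ℝ)) ^ (-γ) * x ^ (-γ))) := by
    rw [Filter.eventually_all_finset]
    intro j hj
    have hjm : (j : ℝ) ≤ m := by exact_mod_cast Nat.lt_succ_iff.1 (Finset.mem_range.1 hj)
    have hu : 0 < ((j : ℝ) + 1) / m := by positivity
    have hv : 0 < (m - j + 1) / (m : ℝ) := div_pos (by linarith) hmR
    have scale : ∀ {w : ℝ}, 0 < w → Tendsto (fun x : ℝ => w * x) (𝓝[>] 0) (𝓝[>] 0) := by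
      intro w hw
      refine tendsto_nhdsWithin_iff.2 ⟨?_, ?_⟩
      · have : Tendsto (fun x : ℝ => w * x) (𝓝 0) (𝓝 (w * 0)) := tendsto_id.const_mul w
        rw [mul_zero] at this
        exact this.mono_left nhdsWithin_le_nhds
      · filter_upwards [self_mem_nhdsWithin] with x hx using mul_pos hw hx
    filter_upwards [(scale hu).eventually hF, (scale hv).eventually hG, self_mem_nhdsWithin]
      with x hx1 hx2 hx
    have hx : 0 < x := hx
    calc F (((j : ℝ) + 1) / m * x) * G ((m - j + 1) / m * x)
        ≤ Real.exp (-(a ^ (1 + γ) * (((j : ℝ) + 1) / m * x) ^ (-γ))) *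
          Real.exp (-(b ^ (1 + γ) * ((m - j + 1) / m * x) ^ (-γ))) :=
          mul_le_mul hx1 hx2 (hG0 _) (Real.exp_pos _).le
      _ ≤ _ := by
          rw [← Real.exp_add, Real.exp_le_exp, Real.mul_rpow hu.le hx.le,
            Real.mul_rpow hv.le hx.le]
          have h5 := add_rpow_mul_rpow_neg_le hγ.le ha hb hu hv
          have e : ((j : ℝ) + 1) / m + (m - j + 1) / m = 1 + 2 / m := by field_simp; ring
          rw [e] at h5
          nlinarith [mul_le_mul_of_nonneg_right h5 (Real.rpow_pos_of_pos hx (-γ)).le]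
  filter_upwards [h4, eventually_mul_exp_rpow_neg_le (c := m + 1) hγ hm, self_mem_nhdsWithin]
    with x hx1 hx2 hx
  calc H x ≤ _ := hH m x hm0 hx
    _ ≤ ∑ j ∈ Finset.range (m + 1), _ := Finset.sum_le_sum hx1
    _ ≤ _ := by simpa using hx2

/-! ### Distribution functions of perpetuities -/

theorem eventually_le_exp_of_perpetuity {γ q r k A : ℝ} {F G : ℝ → ℝ} (hγ : 0 < γ)
    (hq : 0 < q) (hr0 : 0 < r) (hr1 : r < 1) (hrq : r ^ (1 + γ) = q ^ γ)
    (hk : 0 < k) (hA : A < k / (1 - r))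
    (hG0 : ∀ x, 0 ≤ G x) (hG1 : ∀ x, G x ≤ 1)
    (hF : ∀ a, 0 ≤ a → a < k →
      ∀ᶠ x : ℝ in 𝓝[>] 0, F x ≤ Real.exp (-(a ^ (1 + γ) * x ^ (-γ))))
    (hH : ∀ (m : ℕ) (x : ℝ), 0 < m → 0 < x → G x ≤
      ∑ j ∈ Finset.range (m + 1), F (((j : ℝ) + 1) / m * x) * G ((m - j + 1) / m * x / q)) :
    ∃ B, A < B ∧ 0 ≤ B ∧ ∀ᶠ x : ℝ in 𝓝[>] 0, G x ≤ Real.exp (-(B ^ (1 + γ) * x ^ (-γ))) := by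
  have hr : 0 < 1 - r := by linarith
  -- Each iteration needs a strict loss, so `k` is replaced by `k'' < k` for `F` and by `k' < k''`
  -- in the recursion, with `A < k' / (1 - r)` still true.
  obtain ⟨k', hk'1, hk'2⟩ := exists_between (max_lt hk ((lt_div_iff₀ hr).1 hA))
  obtain ⟨k'', hk''1, hk''2⟩ := exists_between hk'2
  have hk'0 : 0 < k' := (le_max_left _ _).trans_lt hk'1
  have step : ∀ B, 0 ≤ B → (∀ᶠ x : ℝ in 𝓝[>] 0, G x ≤ Real.exp (-(B ^ (1 + γ) * x ^ (-γ)))) →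
      ∀ᶠ x : ℝ in 𝓝[>] 0, G x ≤ Real.exp (-((k' + r * B) ^ (1 + γ) * x ^ (-γ))) := by
    intro B hB hGB
    refine eventually_le_exp_of_le_sum (F := F) (G := fun x => G (x / q)) (a := k'')
      (b := r * B) hγ (by linarith) (by positivity) (by positivity) (by linarith)
      (fun x => hG0 _) (hF k'' (by linarith) hk''2) ?_ hH
    have hs : Tendsto (fun x : ℝ => x / q) (𝓝[>] 0) (𝓝[>] 0) := by
      refine tendsto_nhdsWithin_iff.2 ⟨?_, ?_⟩
      · have : Tendsto (fun x : ℝ => x / q) (𝓝 0) (𝓝 (0 / q)) := tendsto_id.div_const q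
        rw [zero_div] at this
        exact this.mono_left nhdsWithin_le_nhds
      · filter_upwards [self_mem_nhdsWithin] with x hx using div_pos hx hq
    filter_upwards [hs.eventually hGB, self_mem_nhdsWithin] with x hx hx0
    have hx0 : 0 < x := hx0
    refine hx.trans_eq ?_
    rw [Real.mul_rpow hr0.le hB, hrq, Real.div_rpow hx0.le hq.le, Real.rpow_neg hq.le]
    field_simp
  have all : ∀ n : ℕ, ∀ᶠ x : ℝ in 𝓝[>] 0, G x ≤
      Real.exp (-((k' / (1 - r) * (1 - r ^ n)) ^ (1 + γ) * x ^ (-γ))) := by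
    intro n
    induction n with
    | zero =>
      refine Eventually.of_forall fun x => ?_
      simpa [Real.zero_rpow (by linarith : 1 + γ ≠ 0)] using hG1 x
    | succ n ih =>
      have h1 : r ^ n ≤ 1 := pow_le_one₀ hr0.le hr1.le
      have h := step _ (mul_nonneg (by positivity) (by linarith)) ih
      have e : k' + r * (k' / (1 - r) * (1 - r ^ n)) = k' / (1 - r) * (1 - r ^ (n + 1)) := by
        field_simp
        ring
      rwa [e] at h
  have hlim : Tendsto (fun n : ℕ => k' / (1 - r) * (1 - r ^ n)) atTop (𝓝 (k' / (1 - r))) := by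
    simpa using ((tendsto_pow_atTop_nhds_zero_of_lt_one hr0.le hr1).const_sub 1).const_mul
      (k' / (1 - r))
  have hAk : A < k' / (1 - r) := (lt_div_iff₀ hr).2 ((le_max_right _ _).trans_lt hk'1)
  obtain ⟨n, hn⟩ := (hlim.eventually_const_lt hAk).exists
  have h1 : r ^ n ≤ 1 := pow_le_one₀ hr0.le hr1.le
  exact ⟨_, hn, mul_nonneg (by positivity) (by linarith), all n⟩

/-- Splitting `x = (1 - r) x + q (r / q) x` enlarges the argument of `G` by `r / q > 1`, so finitely
many splits pass `M`. This rules out the default value `Real.log 0 = 0`. -/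
theorem perpetuity_pos {q r : ℝ} {F G : ℝ → ℝ} (hq : 0 < q) (hqr : q < r) (hr1 : r < 1)
    (hFpos : ∀ x, 0 < x → 0 < F x) (hGm : Monotone G) (hGpos : ∃ M, 0 < G M)
    (hFG : ∀ s t, F s * G t ≤ G (s + q * t)) {x : ℝ} (hx : 0 < x) : 0 < G x := by
  have hq' := hq.ne'
  obtain ⟨M, hM⟩ := hGpos
  have key : ∀ n : ℕ, ∀ x, 0 < x → 0 < G ((r / q) ^ n * x) → 0 < G x := by
    intro n
    induction n with
    | zero => intro x _ h; simpa using h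
    | succ n ih =>
      intro x hx h
      have h1 := ih (r / q * x) (mul_pos (div_pos (hq.trans hqr) hq) hx)
        (by rwa [pow_succ, mul_assoc] at h)
      refine (mul_pos (hFpos ((1 - r) * x) (mul_pos (by linarith) hx)) h1).trans_le
        ((hFG _ _).trans_eq ?_)
      congr 1
      field_simp
      ring
  obtain ⟨n, hn⟩ := pow_unbounded_of_one_lt (M / x) ((one_lt_div hq).2 hqr)
  exact key n x hx (hM.trans_le (hGm ((div_lt_iff₀ hx).1 hn).le))

/-- With `b = r / q`, `b ^ (-γ) = r`, so the bound `C' x ^ (-γ)` reproduces itself: `C' (1 - r) + C'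
r = C'`. Only one additive constant `-log (G δ)` accrues, and the factor `x ^ γ` kills it. -/
theorem eventually_neg_log_perpetuity_lt {γ q r K C : ℝ} {F G : ℝ → ℝ} (hγ : 0 < γ)
    (hq : 0 < q) (hqr : q < r) (hr1 : r < 1) (hrq : r ^ (1 + γ) = q ^ γ)
    (hK : 0 ≤ K) (hC : K / (1 - r) ^ (1 + γ) < C)
    (hFpos : ∀ x, 0 < x → 0 < F x) (hGm : Monotone G) (hG1 : ∀ x, G x ≤ 1)
    (hGpos : ∃ M, 0 < G M) (hFG : ∀ s t, F s * G t ≤ G (s + q * t))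
    (hF : Tendsto (fun x : ℝ => -Real.log (F x) * x ^ γ) (𝓝[>] 0) (𝓝 K)) :
    ∀ᶠ x : ℝ in 𝓝[>] 0, -Real.log (G x) * x ^ γ < C := by
  have hr0 : 0 < r := hq.trans hqr
  have hr : 0 < 1 - r := by linarith
  have hq' := hq.ne'
  have hGp : ∀ x, 0 < x → 0 < G x := fun x hx => perpetuity_pos hq hqr hr1 hFpos hGm hGpos hFG hx
  set b := r / q with hb
  have hb1 : 1 < b := (one_lt_div hq).2 hqr
  have hb0 : 0 < b := by linarith
  have hbr : b ^ (-γ) = r := by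
    rw [Real.rpow_neg hb0.le, hb, Real.div_rpow hr0.le hq.le, ← hrq, Real.rpow_add hr0,
      Real.rpow_one]
    have := (Real.rpow_pos_of_pos hr0 γ).ne'
    field_simp
  have hrp : 0 < (1 - r) ^ (1 + γ) := Real.rpow_pos_of_pos hr _
  obtain ⟨K', hK'1, hK'2⟩ := exists_between ((div_lt_iff₀ hrp).1 hC)
  obtain ⟨δ, hδ0, hδ⟩ := mem_nhdsGT_iff_exists_Ioo_subset.1 (hF.eventually_lt_const hK'1)
  have hδ0 : 0 < δ := hδ0
  set C' := K' / (1 - r) ^ (1 + γ) with hC'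
  have hf : ∀ x, 0 < x → x < δ → -Real.log (F ((1 - r) * x)) ≤ C' * (1 - r) * x ^ (-γ) := by
    intro x hx hxδ
    have h0 : 0 < (1 - r) * x := mul_pos hr hx
    have h1 := hδ (show (1 - r) * x ∈ Set.Ioo 0 δ from ⟨h0, by nlinarith⟩)
    simp only [Set.mem_ofPred_eq] at h1
    rw [← lt_div_iff₀ (Real.rpow_pos_of_pos h0 _)] at h1
    refine h1.le.trans_eq ?_
    rw [hC', Real.mul_rpow hr.le hx.le, Real.rpow_add hr, Real.rpow_neg hx.le, Real.rpow_one]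
    have := (Real.rpow_pos_of_pos hr γ).ne'
    have := (Real.rpow_pos_of_pos hx γ).ne'
    field_simp
  have hA : 0 ≤ -Real.log (G δ) := by
    have := Real.log_nonpos (hGp δ hδ0).le (hG1 δ)
    linarith
  have hC'0 : 0 ≤ C' := div_nonneg (hK.trans hK'1.le) hrp.le
  have key : ∀ n : ℕ, ∀ x, 0 < x → δ ≤ b ^ n * x →
      -Real.log (G x) ≤ C' * x ^ (-γ) + -Real.log (G δ) := by
    intro n
    have base : ∀ x, δ ≤ x → -Real.log (G x) ≤ C' * x ^ (-γ) + -Real.log (G δ) := by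
      intro x hx
      have h1 := Real.log_le_log (hGp δ hδ0) (hGm hx)
      have h2 : 0 ≤ C' * x ^ (-γ) :=
        mul_nonneg hC'0 (Real.rpow_nonneg (hδ0.le.trans hx) _)
      linarith
    induction n with
    | zero => intro x _ h; exact base x (by simpa using h)
    | succ n ih =>
      intro x hx h
      by_cases hxδ : δ ≤ x
      · exact base x hxδ
      have hbx : 0 < b * x := mul_pos hb0 hx
      have h1 := ih (b * x) hbx (by rwa [pow_succ, mul_assoc] at h)
      have h2 := hf x hx (not_le.1 hxδ)
      have h0 : 0 < (1 - r) * x := mul_pos hr hx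
      have e : (1 - r) * x + q * (b * x) = x := by rw [hb]; field_simp; ring
      have h3 := hFG ((1 - r) * x) (b * x)
      rw [e] at h3
      have h4 := Real.log_le_log (mul_pos (hFpos _ h0) (hGp _ hbx)) h3
      rw [Real.log_mul (hFpos _ h0).ne' (hGp _ hbx).ne'] at h4
      rw [Real.mul_rpow hb0.le hx.le, hbr] at h1
      linarith
  have hlim : Tendsto (fun x : ℝ => C' + -Real.log (G δ) * x ^ γ) (𝓝[>] 0) (𝓝 C') := by
    have h1 : Tendsto (fun x : ℝ => x ^ γ) (𝓝 0) (𝓝 ((0 : ℝ) ^ γ)) :=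
      (Real.continuousAt_rpow_const 0 γ (Or.inr hγ.le)).tendsto
    rw [Real.zero_rpow hγ.ne'] at h1
    simpa using ((h1.mono_left nhdsWithin_le_nhds).const_mul (-Real.log (G δ))).const_add C'
  have hC'C : C' < C := (div_lt_iff₀ hrp).2 hK'2
  filter_upwards [hlim.eventually_lt_const hC'C, self_mem_nhdsWithin] with x hx hx0
  have hx0 : 0 < x := hx0
  obtain ⟨n, hn⟩ := pow_unbounded_of_one_lt (δ / x) hb1
  have h1 := mul_le_mul_of_nonneg_right (key n x hx0 ((div_lt_iff₀ hx0).1 hn).le)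
    (Real.rpow_pos_of_pos hx0 γ).le
  rw [add_mul, mul_assoc, ← Real.rpow_add hx0, neg_add_cancel, Real.rpow_zero, mul_one] at h1
  exact h1.trans_lt hx

theorem tendsto_neg_log_perpetuity {γ q K : ℝ} {F G : ℝ → ℝ} (hγ : 0 < γ)
    (hq : 0 < q) (hq1 : q < 1) (hK : 0 < K)
    (hFm : Monotone F) (hF0 : ∀ x, 0 ≤ F x) (hGm : Monotone G) (hG0 : ∀ x, 0 ≤ G x)
    (hG1 : ∀ x, G x ≤ 1)
    (hGpos : ∃ M, 0 < G M) (hFG : ∀ s t, F s * G t ≤ G (s + q * t))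
    (hH : ∀ (m : ℕ) (x : ℝ), 0 < m → 0 < x → G x ≤
      ∑ j ∈ Finset.range (m + 1), F (((j : ℝ) + 1) / m * x) * G ((m - j + 1) / m * x / q))
    (hF : Tendsto (fun x : ℝ => -Real.log (F x) * x ^ γ) (𝓝[>] 0) (𝓝 K)) :
    Tendsto (fun x : ℝ => -Real.log (G x) * x ^ γ) (𝓝[>] 0)
      (𝓝 (K / (1 - q ^ (γ / (1 + γ))) ^ (1 + γ))) := by
  have h1γ : 0 < 1 + γ := by linarith
  set r := q ^ (γ / (1 + γ)) with hrdef
  have hr1 : r < 1 := Real.rpow_lt_one hq.le hq1 (by positivity)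
  have hr : 0 < 1 - r := by linarith
  have hqr : q < r := by
    conv_lhs => rw [← Real.rpow_one q]
    exact Real.rpow_lt_rpow_of_exponent_gt hq hq1 ((div_lt_one h1γ).2 (by linarith))
  have hrq : r ^ (1 + γ) = q ^ γ := by
    rw [hrdef, ← Real.rpow_mul hq.le, div_mul_cancel₀ _ h1γ.ne']
  have hFpos : ∀ x, 0 < x → 0 < F x := by
    intro x hx
    have h1 : ∀ᶠ y : ℝ in 𝓝[>] 0, y < x := mem_nhdsWithin_of_mem_nhds (Iio_mem_nhds hx)
    obtain ⟨y, hy1, hy2⟩ := ((hF.eventually_const_lt hK).and h1).exists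
    -- Since `Real.log 0 = 0`, a zero of `F` at `y` would contradict the positive value there.
    refine lt_of_lt_of_le ((hF0 y).lt_of_ne ?_) (hFm hy2.le)
    intro h
    simp [← h] at hy1
  have hGp : ∀ x, 0 < x → 0 < G x := fun x hx => perpetuity_pos hq hqr hr1 hFpos hGm hGpos hFG hx
  set k := K ^ (1 / (1 + γ)) with hk
  have hk0 : 0 < k := Real.rpow_pos_of_pos hK _
  have hkK : k ^ (1 + γ) = K := by
    rw [hk, ← Real.rpow_mul hK.le, one_div_mul_cancel h1γ.ne', Real.rpow_one]
  rw [tendsto_order]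
  refine ⟨fun c hc => ?_, fun c hc =>
    eventually_neg_log_perpetuity_lt hγ hq hqr hr1 hrq hK.le hc hFpos hGm hG1 hGpos hFG hF⟩
  have hFa : ∀ a, 0 ≤ a → a < k →
      ∀ᶠ x : ℝ in 𝓝[>] 0, F x ≤ Real.exp (-(a ^ (1 + γ) * x ^ (-γ))) := by
    intro a ha hak
    have h1 : a ^ (1 + γ) < K := hkK ▸ Real.rpow_lt_rpow ha hak h1γ
    filter_upwards [hF.eventually_const_lt h1, self_mem_nhdsWithin] with x hx hx0
    have hx0 : 0 < x := hx0
    rw [← Real.log_le_iff_le_exp (hFpos x hx0), Real.rpow_neg hx0.le, ← div_eq_mul_inv]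
    have := (div_lt_iff₀ (Real.rpow_pos_of_pos hx0 γ)).2 hx
    linarith
  have hA : (max c 0) ^ (1 / (1 + γ)) < k / (1 - r) := by
    rw [one_div, Real.rpow_inv_lt_iff_of_pos (le_max_right _ _) (by positivity) h1γ,
      Real.div_rpow hk0.le hr.le, hkK]
    exact max_lt hc (div_pos hK (Real.rpow_pos_of_pos hr _))
  obtain ⟨B, hB1, hB0, hB⟩ := eventually_le_exp_of_perpetuity hγ hq (hq.trans hqr) hr1 hrq hk0 hA
    hG0 hG1 hFa hH
  rw [one_div, Real.rpow_inv_lt_iff_of_pos (le_max_right _ _) hB0 h1γ] at hB1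
  filter_upwards [hB, self_mem_nhdsWithin] with x hx hx0
  have hx0 : 0 < x := hx0
  rw [← Real.log_le_iff_le_exp (hGp x hx0), Real.rpow_neg hx0.le, ← div_eq_mul_inv] at hx
  refine (le_max_left c 0).trans_lt (hB1.trans_le ?_)
  rw [← div_le_iff₀ (Real.rpow_pos_of_pos hx0 γ)]
  linarith

/-! ### Convergence, independence and laws of the series -/

theorem ae_summable_pow_mul {Ω : Type*} [MeasurableSpace Ω] (μ : Measure Ω)
    [IsProbabilityMeasure μ] (X : ℕ → Ω → ℝ)
    (hident : ∀ n, IdentDistrib (X n) (X 0) μ μ) (hnonneg : ∀ n, ∀ᵐ ω ∂μ, 0 ≤ X n ω)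
    (hlog : Integrable (fun ω => Real.log (max (X 0 ω) 1)) μ)
    {q : ℝ} (hq0 : 0 < q) (hq1 : q < 1) :
    ∀ᵐ ω ∂μ, Summable (fun n : ℕ => q ^ n * X n ω) := by
  -- Chosen so that `exp (n c) = q ^ (-n / 2)`: by Borel–Cantelli, eventually `X n ≤ exp (n c)`,
  -- leaving a geometric series in `√q`.
  set c := -Real.log q / 2 with hc
  have hc0 : 0 < c := by have := Real.log_neg hq0 hq1; linarith
  have hψ : Measurable fun x : ℝ => Real.log (max x 1) / c := by fun_prop
  let _ : MeasureSpace Ω := ⟨μ⟩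
  have hsum : ∑' j : ℕ, μ {ω | Real.log (max (X 0 ω) 1) / c ∈ Set.Ioi (j : ℝ)} < ⊤ :=
    tsum_prob_mem_Ioi_lt_top (Ω := Ω) (hlog.div_const c)
      fun ω => div_nonneg (Real.log_nonneg (le_max_right _ _)) hc0.le
  have heq : ∀ j : ℕ, μ {ω | Real.log (max (X j ω) 1) / c ∈ Set.Ioi (j : ℝ)} =
      μ {ω | Real.log (max (X 0 ω) 1) / c ∈ Set.Ioi (j : ℝ)} := fun j =>
    ((hident j).comp hψ).measure_mem_eq measurableSet_Ioi
  have hbc := ae_eventually_notMem (μ := μ)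
    (s := fun j : ℕ => {ω | Real.log (max (X j ω) 1) / c ∈ Set.Ioi (j : ℝ)})
    (by simp_rw [heq]; exact hsum.ne)
  have hs0 : 0 ≤ Real.sqrt q := Real.sqrt_nonneg q
  have hs1 : Real.sqrt q < 1 := by rw [Real.sqrt_lt' one_pos]; simpa using hq1
  filter_upwards [hbc, ae_all_iff.2 hnonneg] with ω hω hpos
  refine Summable.of_norm_bounded_eventually_nat
    (summable_geometric_of_lt_one hs0 hs1) ?_
  filter_upwards [hω] with n hn
  simp only [Set.mem_Ioi, not_lt] at hn
  rw [Real.norm_of_nonneg (mul_nonneg (pow_nonneg hq0.le _) (hpos n))]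
  have h1 : X n ω ≤ Real.exp (n * c) := by
    have h2 : 0 < max (X n ω) 1 := lt_max_of_lt_right one_pos
    exact (le_max_left _ _).trans ((Real.log_le_iff_le_exp h2).1 ((div_le_iff₀ hc0).1 hn))
  have h3 : q ^ n = Real.sqrt q ^ n * Real.sqrt q ^ n := by
    rw [← mul_pow, Real.mul_self_sqrt hq0.le]
  have h4 : Real.exp (n * c) * Real.sqrt q ^ n = 1 := by
    rw [← Real.exp_log (Real.sqrt_pos.2 hq0), ← Real.exp_nat_mul, ← Real.exp_add,
      Real.log_sqrt hq0.le, hc, Real.exp_eq_one_iff]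
    ring
  calc q ^ n * X n ω ≤ q ^ n * Real.exp (n * c) := by gcongr
    _ = Real.sqrt q ^ n * (Real.exp (n * c) * Real.sqrt q ^ n) := by rw [h3]; ring
    _ = Real.sqrt q ^ n := by rw [h4, mul_one]

theorem measurable_tsum_pow_mul_max (q : ℝ) :
    Measurable fun x : ℕ → ℝ => (∑' n, ENNReal.ofReal (q ^ n * max (x n) 0)).toReal := by
  fun_prop

/-- No summability is needed: in the divergent case both sides default to `0`. This makes the sum a
measurable function of the sequence. -/
theorem tsum_pow_mul_eq_toReal {q : ℝ} (hq : 0 ≤ q) {x : ℕ → ℝ} (hx : ∀ n, 0 ≤ x n) :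
    ∑' n, q ^ n * x n = (∑' n, ENNReal.ofReal (q ^ n * max (x n) 0)).toReal := by
  rw [ENNReal.tsum_toReal_eq fun n => ENNReal.ofReal_ne_top]
  refine tsum_congr fun n => ?_
  rw [max_eq_left (hx n), ENNReal.toReal_ofReal (mul_nonneg (pow_nonneg hq n) (hx n))]

theorem iIndepFun.indepFun_zero_succ {Ω : Type*} [MeasurableSpace Ω] {μ : Measure Ω}
    {X : ℕ → Ω → ℝ} (hm : ∀ n, Measurable (X n)) (h : iIndepFun X μ) :
    IndepFun (X 0) (fun ω n => X (n + 1) ω) μ := by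
  have h1 := indep_iSup_of_disjoint (fun n => (hm n).comap_le) h
    (S := {0}) (T := Set.Ioi 0) (by simp)
  refine indep_of_indep_of_le_left (indep_of_indep_of_le_right h1 ?_) ?_
  · rw [MeasurableSpace.pi, MeasurableSpace.comap_iSup]
    refine iSup_le fun n => ?_
    rw [MeasurableSpace.comap_comp]
    exact le_iSup₂_of_le (n + 1) (Nat.succ_pos n) le_rfl
  · exact le_iSup₂_of_le 0 rfl le_rfl

theorem iIndepFun.identDistrib_succ {Ω : Type*} [MeasurableSpace Ω] {μ : Measure Ω}
    {X : ℕ → Ω → ℝ} (hm : ∀ n, Measurable (X n)) (h : iIndepFun X μ)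
    (hident : ∀ n, IdentDistrib (X n) (X 0) μ μ) :
    IdentDistrib (fun ω n => X (n + 1) ω) (fun ω n => X n ω) μ μ where
  aemeasurable_fst := by fun_prop
  aemeasurable_snd := by fun_prop
  map_eq := by
    have h' : iIndepFun (fun n => X (n + 1)) μ := h.precomp (add_left_injective 1)
    rw [h.map_fun_eq_infinitePi_map hm, h'.map_fun_eq_infinitePi_map fun n => hm (n + 1)]
    simp_rw [fun n => (hident n).map_eq]

theorem measureReal_inter_le_of_indepFun {Ω : Type*} [MeasurableSpace Ω] {μ : Measure Ω}
    {Y Z : Ω → ℝ} (h : IndepFun Y Z μ) (s t : ℝ) :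
    μ.real ({ω | Y ω ≤ s} ∩ {ω | Z ω ≤ t}) = μ.real {ω | Y ω ≤ s} * μ.real {ω | Z ω ≤ t} := by
  have := h.measure_inter_preimage_eq_mul (Set.Iic s) (Set.Iic t) measurableSet_Iic
    measurableSet_Iic
  simp only [Measure.real, ← ENNReal.toReal_mul]
  exact congrArg _ this

theorem measureReal_add_mul_le_le_sum {Ω : Type*} [MeasurableSpace Ω] {μ : Measure Ω}
    [IsProbabilityMeasure μ] {Y Z : Ω → ℝ} (h : IndepFun Y Z μ) (hY : ∀ ω, 0 ≤ Y ω)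
    (hZ : ∀ ω, 0 ≤ Z ω) {q : ℝ} (hq : 0 < q) {m : ℕ} (hm : 0 < m) {x : ℝ} (hx : 0 < x) :
    μ.real {ω | Y ω + q * Z ω ≤ x} ≤ ∑ j ∈ Finset.range (m + 1),
      μ.real {ω | Y ω ≤ ((j : ℝ) + 1) / m * x} * μ.real {ω | Z ω ≤ (m - j + 1) / m * x / q} := by
  have hmR : (0 : ℝ) < m := by exact_mod_cast hm
  have hsub : {ω | Y ω + q * Z ω ≤ x} ⊆ ⋃ j ∈ Finset.range (m + 1),
      ({ω | Y ω ≤ ((j : ℝ) + 1) / m * x} ∩ {ω | Z ω ≤ (m - j + 1) / m * x / q}) := by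
    intro ω hω
    simp only [Set.mem_ofPred_eq] at hω
    have hqZ : 0 ≤ q * Z ω := mul_nonneg hq.le (hZ ω)
    have h0 : 0 ≤ Y ω * m / x := div_nonneg (mul_nonneg (hY ω) hmR.le) hx.le
    have h1 := Nat.floor_le h0
    have h2 := (Nat.lt_floor_add_one (Y ω * m / x)).le
    rw [le_div_iff₀ hx] at h1
    rw [div_le_iff₀ hx] at h2
    simp only [Set.mem_iUnion, Finset.mem_range, Set.mem_inter_iff, Set.mem_ofPred_eq]
    -- The cell containing `Y`. The bound `(m - j) / m` would suffice for `q Z`; the extra `1` keeps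
    -- it positive at `j = m`.
    refine ⟨⌊Y ω * m / x⌋₊, ?_, ?_, ?_⟩
    · refine Nat.lt_succ_of_le (Nat.floor_le_of_le ?_)
      rw [div_le_iff₀ hx]
      nlinarith
    · rw [div_mul_eq_mul_div, le_div_iff₀ hmR]
      exact h2
    · rw [le_div_iff₀ hq, div_mul_eq_mul_div, le_div_iff₀ hmR]
      nlinarith
  refine (measureReal_mono hsub (measure_ne_top _ _)).trans ((measureReal_biUnion_finset_le _ _).trans_eq ?_)
  exact Finset.sum_congr rfl fun j _ => measureReal_inter_le_of_indepFun h _ _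

theorem tendsto_neg_log_measureReal_tsum {Ω : Type*} [MeasurableSpace Ω] (μ : Measure Ω)
    [IsProbabilityMeasure μ] (X : ℕ → Ω → ℝ) (hm : ∀ n, Measurable (X n))
    (hindep : iIndepFun X μ) (hident : ∀ n, IdentDistrib (X n) (X 0) μ μ)
    (hpos : ∀ n ω, 0 ≤ X n ω) {q γ K : ℝ} (hq0 : 0 < q) (hq1 : q < 1)
    (hsum : ∀ᵐ ω ∂μ, Summable (fun n : ℕ => q ^ n * X n ω)) (hγ : 0 < γ) (hK : 0 < K)
    (hX : Tendsto (fun ε : ℝ => -Real.log (μ.real {ω | X 0 ω ≤ ε}) * ε ^ γ) (𝓝[>] 0) (𝓝 K)) :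
    Tendsto (fun ε : ℝ => -Real.log (μ.real {ω | ∑' n : ℕ, q ^ n * X n ω ≤ ε}) * ε ^ γ)
      (𝓝[>] 0) (𝓝 (K / (1 - q ^ (γ / (1 + γ))) ^ (1 + γ))) := by
  have hΦ := measurable_tsum_pow_mul_max q
  set Φ := fun x : ℕ → ℝ => (∑' n, ENNReal.ofReal (q ^ n * max (x n) 0)).toReal with hΦdef
  have hS : ∀ ω, ∑' n, q ^ n * X n ω = Φ fun n => X n ω := fun ω =>
    tsum_pow_mul_eq_toReal hq0.le fun n => hpos n ω
  have hS' : ∀ ω, ∑' n, q ^ n * X (n + 1) ω = Φ fun n => X (n + 1) ω := fun ω =>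
    tsum_pow_mul_eq_toReal hq0.le fun n => hpos (n + 1) ω
  have hind : IndepFun (X 0) (fun ω => ∑' n, q ^ n * X (n + 1) ω) μ := by
    simp_rw [hS']
    exact (iIndepFun.indepFun_zero_succ hm hindep).comp measurable_id hΦ
  have hlaw : ∀ t, μ.real {ω | ∑' n, q ^ n * X (n + 1) ω ≤ t} =
      μ.real {ω | ∑' n, q ^ n * X n ω ≤ t} := by
    intro t
    simp_rw [hS, hS']
    exact congrArg ENNReal.toReal
      (((iIndepFun.identDistrib_succ hm hindep hident).comp hΦ).measure_mem_eq measurableSet_Iic)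
  have hdec : ∀ x, μ.real {ω | ∑' n, q ^ n * X n ω ≤ x} =
      μ.real {ω | X 0 ω + q * ∑' n, q ^ n * X (n + 1) ω ≤ x} := by
    intro x
    refine measureReal_congr ?_
    filter_upwards [hsum] with ω hω
    have : ∑' n, q ^ n * X n ω = X 0 ω + q * ∑' n, q ^ n * X (n + 1) ω := by
      rw [hω.tsum_eq_zero_add, ← tsum_mul_left]
      simp only [pow_zero, one_mul, pow_succ', mul_assoc]
    simp only [eq_iff_iff]
    change (_ ≤ x) ↔ (_ ≤ x)
    rw [this]
  refine tendsto_neg_log_perpetuity (F := fun x => μ.real {ω | X 0 ω ≤ x})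
    (G := fun x => μ.real {ω | ∑' n : ℕ, q ^ n * X n ω ≤ x}) hγ hq0 hq1 hK
    (fun s t hst => measureReal_mono fun ω (hω : _ ≤ s) => hω.trans hst)
    (fun _ => measureReal_nonneg)
    (fun s t hst => measureReal_mono fun ω (hω : _ ≤ s) => hω.trans hst)
    (fun _ => measureReal_nonneg) (fun _ => measureReal_le_one) ?_ ?_ ?_ hX
  · by_contra! hcon
    have h0 : μ (⋃ n : ℕ, {ω | ∑' k : ℕ, q ^ k * X k ω ≤ n}) = 0 := by
      refine measure_iUnion_null fun n => ?_
      exact (measureReal_eq_zero_iff).1 (le_antisymm (hcon n) measureReal_nonneg)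
    have h1 : (⋃ n : ℕ, {ω | ∑' k : ℕ, q ^ k * X k ω ≤ n}) = Set.univ :=
      Set.eq_univ_of_forall fun ω => by simpa using exists_nat_ge _
    simp [h1] at h0
  · intro s t
    rw [← hlaw t, hdec (s + q * t), ← measureReal_inter_le_of_indepFun hind]
    refine measureReal_mono fun ω hω => ?_
    exact add_le_add hω.1 (mul_le_mul_of_nonneg_left hω.2 hq0.le)
  · intro m x hm0 hx
    simp only [hdec x]
    simp only [← hlaw]
    exact measureReal_add_mul_le_le_sum hind (hpos 0)
      (fun ω => tsum_nonneg fun n => mul_nonneg (pow_nonneg hq0.le n) (hpos (n + 1) ω)) hq0 hm0 hx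

/-- Small deviations of `S = ∑ qⁿ Xₙ` for i.i.d. a.s. non-negative `Xₙ` with exponentially little
mass near the origin: the series converges almost surely, and its lower tail has the stated
logarithmic asymptotics. -/
theorem mainTheorem1 {Ω : Type*} [MeasurableSpace Ω] (μ : Measure Ω) [IsProbabilityMeasure μ]
    (X : ℕ → Ω → ℝ)
    (hindep : iIndepFun X μ)
    (hident : ∀ n, IdentDistrib (X n) (X 0) μ μ)
    (hnonneg : ∀ᵐ ω ∂μ, 0 ≤ X 0 ω)
    (hlog : Integrable (fun ω => Real.log (max (X 0 ω) 1)) μ)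
    (q : ℝ) (hq0 : 0 < q) (hq1 : q < 1)
    (γ K : ℝ) (hγ : 0 < γ) (hK : 0 < K)
    (hX : (fun ε : ℝ => -Real.log (μ.real {ω | X 0 ω ≤ ε}))
      ~[𝓝[>] (0 : ℝ)] (fun ε : ℝ => K * ε ^ (-γ))) :
    (∀ᵐ ω ∂μ, Summable (fun n : ℕ => q ^ n * X n ω)) ∧
    (fun ε : ℝ => -Real.log (μ.real {ω | ∑' n : ℕ, q ^ n * X n ω ≤ ε}))
      ~[𝓝[>] (0 : ℝ)]
        (fun ε : ℝ => K / (1 - q ^ (γ / (1 + γ))) ^ (1 + γ) * ε ^ (-γ)) := by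
  have hpos : ∀ n, ∀ᵐ ω ∂μ, 0 ≤ X n ω := fun n =>
    (hident n).symm.ae_mem_snd measurableSet_Ici hnonneg
  have hsum := ae_summable_pow_mul μ X hident hpos hlog hq0 hq1
  refine ⟨hsum, ?_⟩
  have hr1 : q ^ (γ / (1 + γ)) < 1 := Real.rpow_lt_one hq0.le hq1 (by positivity)
  have hC : K / (1 - q ^ (γ / (1 + γ))) ^ (1 + γ) ≠ 0 :=
    (div_pos hK (Real.rpow_pos_of_pos (sub_pos.2 hr1) _)).ne'
  rw [isEquivalent_mul_rpow_neg_iff hC]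
  rw [isEquivalent_mul_rpow_neg_iff hK.ne'] at hX
  have hmX : ∀ n, AEMeasurable (X n) μ := fun n => (hident n).aemeasurable_fst
  -- Measurable, everywhere non-negative versions of the `X n`.
  let Y : ℕ → Ω → ℝ := fun n ω => max ((hmX n).mk (X n) ω) 0
  have hYm : ∀ n, Measurable (Y n) := fun n => (hmX n).measurable_mk.max measurable_const
  have hXY : ∀ n, X n =ᵐ[μ] Y n := fun n => by
    filter_upwards [(hmX n).ae_eq_mk, hpos n] with ω h1 h2
    simp only [Y]
    rw [← h1, max_eq_left h2]
  have hYident : ∀ n, IdentDistrib (Y n) (Y 0) μ μ := fun n =>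
    ((IdentDistrib.of_ae_eq (hmX n) (hXY n)).symm.trans (hident n)).trans
      (IdentDistrib.of_ae_eq (hmX 0) (hXY 0))
  have hset : ∀ {f g : Ω → ℝ}, f =ᵐ[μ] g → ∀ x, μ.real {ω | f ω ≤ x} = μ.real {ω | g ω ≤ x} := by
    intro f g hfg x
    refine measureReal_congr ?_
    filter_upwards [hfg] with ω hω
    simp only [eq_iff_iff]
    change (_ ≤ x) ↔ (_ ≤ x)
    rw [hω]
  have hall : ∀ᵐ ω ∂μ, ∀ n, X n ω = Y n ω := ae_all_iff.2 hXY
  have htsum : (fun ω => ∑' n : ℕ, q ^ n * X n ω) =ᵐ[μ] fun ω => ∑' n : ℕ, q ^ n * Y n ω := by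
    filter_upwards [hall] with ω hω
    simp only [hω]
  simp only [hset htsum]
  refine tendsto_neg_log_measureReal_tsum μ Y hYm (hindep.congr hXY) hYident
    (fun n ω => le_max_right _ _) hq0 hq1 ?_ hγ hK ?_
  · filter_upwards [hsum, hall] with ω h1 h2
    simpa only [h2] using h1
  · simpa only [hset (hXY 0)] using hX
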